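/- Let $\lambda\in(0,1)$ and let $m,n$ be integers with $1\le m\le n-2$. Write $E\in\mathcal A(\lambda,n,m)$ if $E\subset\mathbb R$ is a nonempty compact set with $E=\bigcup_{i=1}^n f_i(E)$, where $f_i(x)=\lambda x+b_i$ for some reals $0=b_1<b_2<\dots<b_n=1-\lambda$ such that the intervals $I_i=f_i([0,1])$ satisfy $\frac{|I_i\cap I_{i+1}|}{|I_i|}\in\{0,\lambda\}$ whenever $1\le i\le n-1$ and $I_i\cap I_{i+1}\ne\emptyset$, and exactly $m$ indices $i\in\{1,\dots,n-1\}$ satisfy $\frac{|I_i\cap I_{i+1}|}{|I_i|}=\lambda$; here $|\cdot|$ denotes length. Let $E\in\mathcal A(\lambda,n,m)$. Let $F=\bigcup_{j=1}^t g_j(F)$ be a dust-like self-similar set, that is, a nonempty compact subset of some $\mathbb R^d$, where $g_j:\mathbb R^d\to\mathbb R^d$ satisfies $|g_j(x)-g_j(y)|=r_j|x-y|$ for all $x,y\in\mathbb R^d$ with $r_j\in(0,1)$, and the sets $g_1(F),\dots,g_t(F)$ are pairwise disjoint. Suppose that $E$ and $F$ are Lipschitz equivalent: there are a bijection $f:E\to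 F$ and a constant $C>0$ with $C^{-1}|x-y|\le|f(x)-f(y)|\le C|x-y|$ for all $x,y\in E$. Then, after renumbering $g_1,\dots,g_t$ if necessary, there are $r\in(0,1)$ and positive integers $k$ and $k_1\le k_2\le\dots\le k_t$ such that $$\lambda=r^k,\qquad r_j=r^{k_j}\quad(1\le j\le t).$$ -/

import Mathlib

open Set MeasureTheory

/-- `F` is a self-similar set of Euclidean space: a nonempty compact set which is the union of its
images under the finitely many contractive similitudes `g j`, with ratios `ρ j ∈ (0, 1)`. -/
structure IsSelfSimilarSet {d t : ℕ}
    (g : Fin t → EuclideanSpace ℝ (Fin d) → EuclideanSpace ℝ (Fin d)) (ρ : Fin t → ℝ)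
    (F : Set (EuclideanSpace ℝ (Fin d))) : Prop where
  ratio_pos : ∀ j, 0 < ρ j
  ratio_lt_one : ∀ j, ρ j < 1
  similitude : ∀ j x y, dist (g j x) (g j y) = ρ j * dist x y
  isCompact : IsCompact F
  nonempty : F.Nonempty
  eq_iUnion : F = ⋃ j, g j '' F

/-- `F` is a dust-like self-similar set generated by `g` with ratios `ρ`: the strong separation
condition holds. -/
structure IsDustLike {d t : ℕ}
    (g : Fin t → EuclideanSpace ℝ (Fin d) → EuclideanSpace ℝ (Fin d)) (ρ : Fin t → ℝ)
    (F : Set (EuclideanSpace ℝ (Fin d))) : Prop extends IsSelfSimilarSet g ρ F where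
  separated : ∀ i j, i ≠ j → g i '' F ∩ g j '' F = ∅

/-- The map `f_i(x) = lam * x + b_i` of the line. -/
def overlapMap {n : ℕ} (lam : ℝ) (b : Fin n → ℝ) (i : Fin n) (x : ℝ) : ℝ := lam * x + b i

/-- The interval `I_i = f_i([0, 1])`. -/
def overlapInterval {n : ℕ} (lam : ℝ) (b : Fin n → ℝ) (i : Fin n) : Set ℝ :=
  overlapMap lam b i '' Icc (0 : ℝ) 1

/-- The relative length `|I_i ∩ I_j| / |I_i|`. -/
noncomputable def overlapRatio {n : ℕ} (lam : ℝ) (b : Fin n → ℝ) (i j : Fin n) : ℝ :=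
  (volume (overlapInterval lam b i ∩ overlapInterval lam b j)).toReal /
    (volume (overlapInterval lam b i)).toReal

/-- The conditions on `lam`, `n`, `m` and the translations `b` (indexed from `0` to `n - 1`) which
define the class `A(lam, n, m)`. -/
structure IsExactOverlapSystem {n : ℕ} (lam : ℝ) (m : ℕ) (b : Fin n → ℝ) : Prop where
  lam_pos : 0 < lam
  lam_lt_one : lam < 1
  one_le : 1 ≤ m
  add_two_le : m + 2 ≤ n
  strictMono : StrictMono b
  first_eq : ∀ i : Fin n, (i : ℕ) = 0 → b i = 0
  last_eq : ∀ i : Fin n, (i : ℕ) + 1 = n → b i = 1 - lam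
  ratio_mem : ∀ i j : Fin n, (j : ℕ) = (i : ℕ) + 1 →
    (overlapInterval lam b i ∩ overlapInterval lam b j).Nonempty →
      overlapRatio lam b i j ∈ ({0, lam} : Set ℝ)
  card_eq : {i : Fin n | ∃ j : Fin n, (j : ℕ) = (i : ℕ) + 1 ∧ overlapRatio lam b i j = lam}.ncard = m

/-- The class `A(lam, n, m)` of self-similar sets with exact overlaps. -/
def exactOverlapClass (lam : ℝ) (n m : ℕ) : Set (Set ℝ) :=
  {E | ∃ b : Fin n → ℝ, IsExactOverlapSystem lam m b ∧
    IsCompact E ∧ E.Nonempty ∧ E = ⋃ i, overlapMap lam b i '' E}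

/-- Lipschitz equivalence of two sets: there is a bi-Lipschitz bijection between them. -/
def LipschitzEquivalent {X Y : Type*} [MetricSpace X] [MetricSpace Y] (A : Set X) (B : Set Y) :
    Prop :=
  ∃ f : A → B, Function.Bijective f ∧ ∃ C : ℝ, 0 < C ∧
    ∀ x y : A, C⁻¹ * dist x y ≤ dist (f x) (f y) ∧ dist (f x) (f y) ≤ C * dist x y

/-! Let `s` solve `∑ j, ρ j ^ s = 1`, and let `φ : F → E` be bi-Lipschitz. For a word `w` put `a w =
μH[s] (φ '' F_w)`, where `F_w` is the cylinder of `w`. Since `0 < μH[s] F < ∞`, `a` is positive,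
additive over children and bounded by a multiple of `wordProd ρ w ^ s`.

The cylinder `F_w` is separated from the rest of `F` at scale `wordProd ρ w`, so `φ '' F_w` is a
union of level `N` cylinders of `E` with `lam ^ N` comparable to `wordProd ρ w`. Exact overlaps give
`E` finite type (`finite_type`): up to similarity only finitely many such unions occur, hence `a w =
(lam ^ N) ^ s * v` with `v` in a finite set (`finite_values`).

Along words nearly maximizing `a w / wordProd ρ w ^ s`, appending `l` letters `j` multiplies `a` by
nearly `ρ j ^ (s * l)`. These factors lie in a finite set, so equality is eventually exact; two
values of `l` sharing the same `v` make a power of `ρ j` a power of `lam`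
(`exists_pow_eq_pow_of_finite_values`). A common root follows. -/

theorem Set.Finite.exists_pos_le_of_pos {T : Set ℝ} (hT : T.Finite) :
    ∃ η > 0, ∀ x ∈ T, 0 < x → η ≤ x := by
  induction T, hT using Set.Finite.induction_on with
  | empty => exact ⟨1, one_pos, by simp⟩
  | @insert a T _ _ ih =>
    obtain ⟨η, hη, h⟩ := ih
    by_cases ha : 0 < a
    · refine ⟨min η a, lt_min hη ha, ?_⟩
      rintro x (rfl | hx) hpos
      · exact min_le_right _ _
      · exact (min_le_left _ _).trans (h x hx hpos)
    · refine ⟨η, hη, ?_⟩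
      rintro x (rfl | hx) hpos
      · exact absurd hpos ha
      · exact h x hx hpos

/-! ### Relative positions of the cylinders of `E`: finite type. -/

theorem overlapInterval_eq {n : ℕ} {lam : ℝ} (hl : 0 < lam) (b : Fin n → ℝ) (i : Fin n) :
    overlapInterval lam b i = Icc (b i) (b i + lam) := by
  ext x
  simp only [overlapInterval, overlapMap, mem_image, mem_Icc]
  constructor
  · rintro ⟨y, ⟨h0, h1⟩, rfl⟩
    constructor <;> nlinarith
  · rintro ⟨h0, h1⟩
    refine ⟨(x - b i) / lam, ⟨div_nonneg (by linarith) hl.le, ?_⟩, by field_simp; ring⟩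
    rw [div_le_one hl]; linarith

theorem overlapRatio_eq {n : ℕ} {lam : ℝ} (hl : 0 < lam) {b : Fin n → ℝ} {i j : Fin n}
    (h : b i ≤ b j) (h' : b j ≤ b i + lam) :
    overlapRatio lam b i j = (lam - (b j - b i)) / lam := by
  have h1 : Icc (b i) (b i + lam) ∩ Icc (b j) (b j + lam) = Icc (b j) (b i + lam) := by
    rw [Icc_inter_Icc, sup_eq_right.2 h, inf_eq_left.2 (by linarith)]
  rw [overlapRatio, overlapInterval_eq hl, overlapInterval_eq hl, h1, Real.volume_Icc,
    Real.volume_Icc, ENNReal.toReal_ofReal (by linarith), ENNReal.toReal_ofReal (by linarith)]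
  congr 1 <;> ring

namespace IsExactOverlapSystem

variable {n : ℕ} {lam : ℝ} {m : ℕ} {b : Fin n → ℝ}

theorem gap_succ (h : IsExactOverlapSystem lam m b) {i j : Fin n} (hij : (j : ℕ) = i + 1) :
    b j - b i = lam - lam ^ 2 ∨ lam ≤ b j - b i := by
  have hl := h.lam_pos
  by_cases hg : b j - b i < lam
  · left
    have hlt : b i < b j := h.strictMono (by rw [Fin.lt_def]; omega)
    have hr := overlapRatio_eq hl hlt.le (by linarith)
    have hne : (overlapInterval lam b i ∩ overlapInterval lam b j).Nonempty := by
      rw [overlapInterval_eq hl, overlapInterval_eq hl]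
      exact ⟨b j, ⟨hlt.le, by linarith⟩, ⟨le_rfl, by linarith⟩⟩
    have := h.ratio_mem i j hij hne
    rw [hr] at this
    rcases this with h0 | h0
    · rw [div_eq_zero_iff] at h0
      rcases h0 with h0 | h0 <;> linarith
    · rw [mem_singleton_iff, div_eq_iff hl.ne'] at h0
      nlinarith
  · right; linarith

theorem sub_sq_le (h : IsExactOverlapSystem lam m b) {i j : Fin n} (hij : i < j) :
    lam - lam ^ 2 ≤ b j - b i := by
  have hl := h.lam_pos
  have hj : (i : ℕ) + 1 < n := lt_of_le_of_lt (Fin.lt_def.1 hij) j.2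
  have h1 := h.gap_succ (i := i) (j := ⟨i + 1, hj⟩) rfl
  have h2 : b ⟨i + 1, hj⟩ ≤ b j := h.strictMono.monotone (by rw [Fin.le_def]; exact hij)
  rcases h1 with h1 | h1 <;> nlinarith

/-- There are `n - 1` consecutive pairs and only `m ≤ n - 2` of them overlap. -/
theorem exists_gap (h : IsExactOverlapSystem lam m b) :
    ∃ i j : Fin n, (j : ℕ) = i + 1 ∧ lam ≤ b j - b i := by
  by_contra! hcon
  have hl := h.lam_pos
  have hn := h.add_two_le
  have hsub : {i : Fin n | (i : ℕ) + 1 < n} ⊆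
      {i : Fin n | ∃ j : Fin n, (j : ℕ) = (i : ℕ) + 1 ∧ overlapRatio lam b i j = lam} := by
    intro i hi
    refine ⟨⟨i + 1, hi⟩, rfl, ?_⟩
    have h1 := hcon i ⟨i + 1, hi⟩ rfl
    have h2 := (h.gap_succ (i := i) (j := ⟨i + 1, hi⟩) rfl).resolve_right (not_le.2 h1)
    have h3 : b i < b ⟨i + 1, hi⟩ := h.strictMono (by rw [Fin.lt_def]; simp)
    rw [overlapRatio_eq hl h3.le (by linarith), h2]
    field_simp; ring
  have hcard := Set.ncard_le_ncard hsub (Set.toFinite _)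
  rw [h.card_eq] at hcard
  have h4 : {i : Fin n | (i : ℕ) + 1 < n} = {(⟨n - 1, by omega⟩ : Fin n)}ᶜ := by
    ext i
    simp only [mem_ofPred_eq, mem_compl_iff, mem_singleton_iff, Fin.ext_iff]
    have := i.2
    omega
  rw [h4, Set.ncard_compl, Set.ncard_singleton, Nat.card_fin] at hcard
  omega

theorem nonneg (h : IsExactOverlapSystem lam m b) (i : Fin n) : 0 ≤ b i := by
  have hn := h.add_two_le
  rw [← h.first_eq ⟨0, by omega⟩ rfl]
  exact h.strictMono.monotone (by rw [Fin.le_def]; simp)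

theorem le_one_sub (h : IsExactOverlapSystem lam m b) (i : Fin n) : b i ≤ 1 - lam := by
  have hn := h.add_two_le
  rw [← h.last_eq ⟨n - 1, by omega⟩ (by simp; omega)]
  exact h.strictMono.monotone (by rw [Fin.le_def]; have := i.2; simp; omega)

/-- As `n ≥ 3`, the total spread `1 - lam` contains a gap of at least `lam` and another of at least
`lam - lam ^ 2`. -/
theorem lam_lt_half (h : IsExactOverlapSystem lam m b) : lam < 1 / 2 := by
  have hl := h.lam_pos
  have hl1 := h.lam_lt_one
  have hn := h.add_two_le
  have hm := h.one_le
  obtain ⟨i, j, hij, hg⟩ := h.exists_gap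
  have h0 := h.first_eq ⟨0, by omega⟩ rfl
  have h1 := h.last_eq ⟨n - 1, by omega⟩ (by simp; omega)
  have key : 2 * lam - lam ^ 2 ≤ 1 - lam := by
    by_cases hi : (i : ℕ) = 0
    · have h2 := h.sub_sq_le (i := j) (j := ⟨n - 1, by omega⟩) (by rw [Fin.lt_def]; simp; omega)
      have h3 := h.first_eq i hi
      linarith
    · have h2 := h.sub_sq_le (i := ⟨0, by omega⟩) (j := i) (by rw [Fin.lt_def]; simp; omega)
      have h3 := h.le_one_sub j
      linarith
  nlinarith

/-- Indices that are not adjacent are at least two gaps apart, and `2 * (lam - lam ^ 2) ≥ lam`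
because `lam < 1 / 2`. -/
theorem gap (h : IsExactOverlapSystem lam m b) {i j : Fin n} (hij : i < j) :
    b j - b i = lam - lam ^ 2 ∨ lam ≤ b j - b i := by
  have hl := h.lam_pos
  have hh := h.lam_lt_half
  rcases Nat.lt_or_ge (i + 1) j with h1 | h1
  · right
    have h2 := h.sub_sq_le (i := i) (j := ⟨i + 1, by omega⟩) (by rw [Fin.lt_def]; simp)
    have h3 := h.sub_sq_le (i := ⟨i + 1, by omega⟩) (j := j) (by rw [Fin.lt_def]; exact h1)
    nlinarith
  · exact h.gap_succ (by rw [Fin.lt_def] at hij; omega)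

/-- The possible relative positions of two cylinders of equal level whose intervals meet. -/
def meetingOffsets (lam : ℝ) : Set ℝ := {0, 1 - lam, lam - 1, 1, -1}

theorem dist_zero_cases (h : IsExactOverlapSystem lam m b) (i : Fin n) :
    b i = 0 ∨ b i = lam - lam ^ 2 ∨ lam ≤ b i := by
  have hn := h.add_two_le
  by_cases hi : (i : ℕ) = 0
  · exact Or.inl (h.first_eq i hi)
  · right
    have := h.gap (i := ⟨0, by omega⟩) (j := i) (by rw [Fin.lt_def]; simp; omega)
    rwa [h.first_eq ⟨0, by omega⟩ rfl, sub_zero] at this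

theorem dist_one_cases (h : IsExactOverlapSystem lam m b) (i : Fin n) :
    1 - lam - b i = 0 ∨ 1 - lam - b i = lam - lam ^ 2 ∨ lam ≤ 1 - lam - b i := by
  have hn := h.add_two_le
  by_cases hi : (i : ℕ) + 1 = n
  · exact Or.inl (by rw [h.last_eq i hi, sub_self])
  · right
    have := h.gap (i := i) (j := ⟨n - 1, by omega⟩)
      (by rw [Fin.lt_def]; have := i.2; simp; omega)
    rwa [h.last_eq ⟨n - 1, by omega⟩ (by simp; omega)] at this

theorem offset_zero (h : IsExactOverlapSystem lam m b) (i j : Fin n)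
    (he : |(b i - b j) / lam| ≤ 1) : (b i - b j) / lam ∈ meetingOffsets lam := by
  have hl := h.lam_pos
  wlog hij : j ≤ i generalizing i j
  · have h1 := this j i (by rwa [← abs_neg, ← neg_div, neg_sub]) (le_of_not_ge hij)
    rw [← neg_sub, neg_div]
    simp only [meetingOffsets, mem_insert_iff, mem_singleton_iff] at h1 ⊢
    rcases h1 with h1 | h1 | h1 | h1 | h1 <;> simp [h1]
  rcases hij.eq_or_lt with rfl | hij
  · simp [meetingOffsets]
  · rw [abs_le, div_le_one hl] at he
    simp only [meetingOffsets, mem_insert_iff, mem_singleton_iff]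
    rcases h.gap hij with h1 | h1
    · right; left; rw [h1]; field_simp
    · right; right; right; left; rw [le_antisymm he.2 h1]; field_simp

/-- The numerator is `b i + (1 - lam - b j)`, and each summand is `0`, `lam - lam ^ 2` or at least
`lam`. A sum of at most `lam` can only be `0`, `lam - lam ^ 2` or `lam`. -/
theorem offset_one_sub (h : IsExactOverlapSystem lam m b) (i j : Fin n)
    (he : (1 - lam + (b i - b j)) / lam ≤ 1) :
    (1 - lam + (b i - b j)) / lam ∈ meetingOffsets lam := by
  have hl := h.lam_pos
  have hh := h.lam_lt_half
  rw [div_le_one hl] at he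
  have hi := h.nonneg i
  have hj := h.le_one_sub j
  simp only [meetingOffsets, mem_insert_iff, mem_singleton_iff]
  have e : 1 - lam + (b i - b j) = b i + (1 - lam - b j) := by ring
  rw [e] at he ⊢
  rcases h.dist_zero_cases i with hu | hu | hu
  · rcases h.dist_one_cases j with hv | hv | hv
    · left; rw [hu, hv]; simp
    · right; left; rw [hu, hv]; field_simp; ring
    · right; right; right; left
      rw [div_eq_one_iff_eq hl.ne']; linarith
  · rcases h.dist_one_cases j with hv | hv | hv
    · right; left; rw [hu, hv]; field_simp; ring
    · nlinarith
    · nlinarith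
  · right; right; right; left
    rw [div_eq_one_iff_eq hl.ne']; linarith

theorem offset_one (h : IsExactOverlapSystem lam m b) (i j : Fin n)
    (he : (1 + (b i - b j)) / lam ≤ 1) :
    (1 + (b i - b j)) / lam ∈ meetingOffsets lam := by
  have hl := h.lam_pos
  rw [div_le_one hl] at he
  have hi := h.nonneg i
  have hj := h.le_one_sub j
  simp only [meetingOffsets, mem_insert_iff, mem_singleton_iff]
  right; right; right; left
  rw [div_eq_one_iff_eq hl.ne']; linarith

theorem neg_mem_meetingOffsets {x : ℝ} : -x ∈ meetingOffsets lam ↔ x ∈ meetingOffsets lam := by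
  simp only [meetingOffsets, mem_insert_iff, mem_singleton_iff, neg_eq_iff_eq_neg, neg_zero,
    neg_sub, neg_neg]
  tauto

/-- Exactness of the overlaps enters here: as long as the intervals meet, subdivision creates no new
relative position. -/
theorem offset_mem (h : IsExactOverlapSystem lam m b) {x : ℝ} (hx : x ∈ meetingOffsets lam)
    (i j : Fin n) (he : |(x + (b i - b j)) / lam| ≤ 1) :
    (x + (b i - b j)) / lam ∈ meetingOffsets lam := by
  rcases hx with rfl | rfl | rfl | rfl | rfl
  · rw [zero_add] at he ⊢
    exact h.offset_zero i j he
  · exact h.offset_one_sub i j (le_of_abs_le he)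
  · have e : (lam - 1 + (b i - b j)) / lam = -((1 - lam + (b j - b i)) / lam) := by ring
    rw [e, abs_neg] at he
    rw [e, neg_mem_meetingOffsets]
    exact h.offset_one_sub j i (le_of_abs_le he)
  · exact h.offset_one i j (le_of_abs_le he)
  · have e : (-1 + (b i - b j)) / lam = -((1 + (b j - b i)) / lam) := by ring
    rw [e, abs_neg] at he
    rw [e, neg_mem_meetingOffsets]
    exact h.offset_one j i (le_of_abs_le he)

/-- Once two intervals are disjoint, their relative gap `|x| - 1` is expanded by at least `lam⁻¹` at
each subdivision, so a pair at bounded relative distance separated boundedly many steps ago. -/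
theorem abs_offset_ge (h : IsExactOverlapSystem lam m b) (x : ℝ) (i j : Fin n) :
    (|x| - 1) / lam ≤ |(x + (b i - b j)) / lam| - 1 := by
  have hl := h.lam_pos
  rw [abs_div, abs_of_pos hl, le_sub_iff_add_le, div_add_one hl.ne']
  gcongr
  have h1 : |b i - b j| ≤ 1 - lam := by
    rw [abs_le]
    constructor <;> linarith [h.nonneg i, h.nonneg j, h.le_one_sub i, h.le_one_sub j]
  have h2 := abs_sub_abs_le_abs_sub x (-(b i - b j))
  rw [abs_neg, sub_neg_eq_add] at h2
  linarith

/-- The relative positions reached from the meeting ones in `a` subdivisions. -/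
def offsets (lam : ℝ) (b : Fin n → ℝ) : ℕ → Set ℝ
  | 0 => meetingOffsets lam
  | a + 1 => (fun p : ℝ × Fin n × Fin n => (p.1 + (b p.2.1 - b p.2.2)) / lam) ''
      (offsets lam b a ×ˢ univ)

theorem finite_offsets (lam : ℝ) (b : Fin n → ℝ) (a : ℕ) : (offsets lam b a).Finite := by
  induction a with
  | zero => simp [offsets, meetingOffsets]
  | succ a ih => exact (ih.prod Set.finite_univ).image _

end IsExactOverlapSystem

/-- The left endpoints of the level `N` intervals. -/
def levelPoints {n : ℕ} (lam : ℝ) (b : Fin n → ℝ) : ℕ → Set ℝ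
  | 0 => {0}
  | N + 1 => {x | ∃ y ∈ levelPoints lam b N, ∃ i, x = y + lam ^ N * b i}

namespace IsExactOverlapSystem

variable {n : ℕ} {lam : ℝ} {m : ℕ} {b : Fin n → ℝ}

theorem exists_offset_growth (h : IsExactOverlapSystem lam m b) :
    ∃ η > 0, ∀ N, ∀ x ∈ levelPoints lam b N, ∀ y ∈ levelPoints lam b N,
      (x - y) / lam ^ N ∈ meetingOffsets lam ∨
      ∃ a, (x - y) / lam ^ N ∈ offsets lam b a ∧ η * (lam⁻¹) ^ a ≤ |(x - y) / lam ^ N| - 1 := by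
  have hl := h.lam_pos
  obtain ⟨η, hη, hmin⟩ := ((finite_offsets lam b 1).image (fun x => |x| - 1)).exists_pos_le_of_pos
  -- The pair first separates at `a = 1`, with gap at least `η`; the factor `lam` compensates for
  -- this shift.
  refine ⟨η * lam, by positivity, fun N => ?_⟩
  induction N with
  | zero =>
    rintro x rfl y rfl
    left; simp [meetingOffsets]
  | succ N ih =>
    rintro _ ⟨x, hx, i, rfl⟩ _ ⟨y, hy, j, rfl⟩
    have e : (x + lam ^ N * b i - (y + lam ^ N * b j)) / lam ^ (N + 1) =
        ((x - y) / lam ^ N + (b i - b j)) / lam := by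
      field_simp; ring
    rw [e]
    rcases ih x hx y hy with h0 | ⟨a, ha, hg⟩
    · by_cases h1 : |((x - y) / lam ^ N + (b i - b j)) / lam| ≤ 1
      · exact Or.inl (h.offset_mem h0 i j h1)
      · right
        have hmem : ((x - y) / lam ^ N + (b i - b j)) / lam ∈ offsets lam b 1 :=
          ⟨((x - y) / lam ^ N, i, j), ⟨h0, trivial⟩, rfl⟩
        refine ⟨1, hmem, ?_⟩
        have := hmin _ ⟨_, hmem, rfl⟩ (by simpa using h1)
        rw [pow_one, mul_assoc, mul_inv_cancel₀ hl.ne', mul_one]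
        exact this
    · right
      refine ⟨a + 1, ⟨((x - y) / lam ^ N, i, j), ⟨ha, trivial⟩, rfl⟩, ?_⟩
      refine le_trans ?_ (h.abs_offset_ge _ i j)
      rw [pow_succ, ← mul_assoc, ← div_eq_mul_inv]
      gcongr

/-- Cylinders of equal level at bounded relative distance have finitely many relative
positions. -/
theorem finite_type (h : IsExactOverlapSystem lam m b) (R : ℝ) :
    ∃ S : Set ℝ, S.Finite ∧ ∀ N, ∀ x ∈ levelPoints lam b N, ∀ y ∈ levelPoints lam b N,
      |x - y| ≤ R * lam ^ N → (x - y) / lam ^ N ∈ S := by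
  have hl := h.lam_pos
  obtain ⟨η, hη, hgrow⟩ := h.exists_offset_growth
  obtain ⟨L, hL⟩ := pow_unbounded_of_one_lt (R / η) ((one_lt_inv₀ hl).2 h.lam_lt_one)
  refine ⟨⋃ a ∈ Iic L, offsets lam b a, (Set.finite_Iic L).biUnion fun a _ => finite_offsets _ _ a,
    fun N x hx y hy hxy => ?_⟩
  rw [mem_iUnion₂]
  rcases hgrow N x hx y hy with h0 | ⟨a, ha, hg⟩
  · exact ⟨0, Nat.zero_le L, h0⟩
  · refine ⟨a, ?_, ha⟩
    by_contra hcon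
    have h1 : |(x - y) / lam ^ N| ≤ R := by
      rw [abs_div, abs_of_pos (pow_pos hl N), div_le_iff₀ (pow_pos hl N)]
      exact hxy
    have h2 : lam⁻¹ ^ L ≤ lam⁻¹ ^ a :=
      pow_le_pow_right₀ ((one_lt_inv₀ hl).2 h.lam_lt_one).le (by simp at hcon; omega)
    rw [div_lt_iff₀ hη] at hL
    nlinarith

end IsExactOverlapSystem

theorem eq_biUnion_levelPoints {n : ℕ} {lam : ℝ} {b : Fin n → ℝ} {E : Set ℝ}
    (hE : E = ⋃ i, overlapMap lam b i '' E) (N : ℕ) :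
    E = ⋃ x ∈ levelPoints lam b N, (fun e => x + lam ^ N * e) '' E := by
  induction N with
  | zero => simp [levelPoints]
  | succ N ih =>
    refine Subset.antisymm (fun e he => ?_) (fun e he => ?_)
    · rw [ih] at he
      simp only [mem_iUnion, mem_image] at he
      obtain ⟨x, hx, e', he', rfl⟩ := he
      rw [hE] at he'
      simp only [mem_iUnion, mem_image] at he' ⊢
      obtain ⟨i, e'', he'', rfl⟩ := he'
      exact ⟨_, ⟨x, hx, i, rfl⟩, e'', he'', by simp only [overlapMap]; ring⟩
    · simp only [mem_iUnion, mem_image] at he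
      obtain ⟨_, ⟨x, hx, i, rfl⟩, e', he', rfl⟩ := he
      rw [ih]
      simp only [mem_iUnion, mem_image]
      refine ⟨x, hx, overlapMap lam b i e', ?_, by simp only [overlapMap]; ring⟩
      rw [hE]
      exact mem_iUnion.2 ⟨i, e', he', rfl⟩

/-! ### Words, the Moran equation and scaling of Hausdorff measure. -/

open Filter Topology

/-- The composition `g_{w₁} ∘ g_{w₂} ∘ ⋯` along a word. -/
def wordMap {ι X : Type*} (g : ι → X → X) : List ι → X → X
  | [] => id
  | j :: w => g j ∘ wordMap g w

/-- The product of weights along a word. -/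
def wordProd {ι : Type*} (ρ : ι → ℝ) (w : List ι) : ℝ := (w.map ρ).prod

section Words

variable {ι X : Type*} {ρ : ι → ℝ}

@[simp] theorem wordProd_nil : wordProd ρ [] = 1 := rfl

@[simp] theorem wordProd_cons (j : ι) (w : List ι) : wordProd ρ (j :: w) = ρ j * wordProd ρ w := by
  simp [wordProd]

@[simp] theorem wordProd_append (v w : List ι) :
    wordProd ρ (v ++ w) = wordProd ρ v * wordProd ρ w := by
  simp [wordProd]

theorem wordProd_replicate (l : ℕ) (j : ι) : wordProd ρ (List.replicate l j) = ρ j ^ l := by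
  simp [wordProd]

theorem wordProd_pos (h : ∀ j, 0 < ρ j) (w : List ι) : 0 < wordProd ρ w := by
  induction w with
  | nil => simp
  | cons j w ih => rw [wordProd_cons]; exact mul_pos (h j) ih

theorem wordProd_le_pow {q : ℝ} (h : ∀ j, 0 < ρ j) (hq : ∀ j, ρ j ≤ q) (w : List ι) :
    wordProd ρ w ≤ q ^ w.length := by
  induction w with
  | nil => simp
  | cons j w ih =>
    rw [wordProd_cons, List.length_cons, pow_succ']
    exact mul_le_mul (hq j) ih (wordProd_pos h w).le ((h j).le.trans (hq j))

theorem wordProd_rpow (h : ∀ j, 0 < ρ j) (s : ℝ) (w : List ι) :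
    wordProd (fun j => ρ j ^ s) w = wordProd ρ w ^ s := by
  induction w with
  | nil => simp
  | cons j w ih =>
    rw [wordProd_cons, wordProd_cons, ih, Real.mul_rpow (h j).le (wordProd_pos h w).le]

theorem wordMap_append (g : ι → X → X) (v w : List ι) :
    wordMap g (v ++ w) = wordMap g v ∘ wordMap g w := by
  induction v with
  | nil => rfl
  | cons j v ih => rw [List.cons_append, wordMap, wordMap, ih, Function.comp_assoc]

end Words

/-- The sum is continuous in `s`, equals `t ≥ 2` at `0` and tends to `0` at infinity. -/
theorem exists_sum_rpow_eq_one {t : ℕ} (ht : 2 ≤ t) {ρ : Fin t → ℝ} (h0 : ∀ j, 0 < ρ j)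
    (h1 : ∀ j, ρ j < 1) : ∃ s : ℝ, 0 < s ∧ ∑ j, ρ j ^ s = 1 := by
  have hlim : Tendsto (fun s : ℝ => ∑ j, ρ j ^ s) atTop (𝓝 0) := by
    have := tendsto_finsetSum (Finset.univ : Finset (Fin t)) fun j _ =>
      tendsto_rpow_atTop_of_base_lt_one (ρ j) (by linarith [h0 j]) (h1 j)
    simpa using this
  obtain ⟨S, hS, hS0⟩ := ((hlim.eventually (gt_mem_nhds one_pos)).and
    (eventually_ge_atTop 0)).exists
  have hcont : Continuous fun s : ℝ => ∑ j, ρ j ^ s :=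
    continuous_finsetSum _ fun j _ => Real.continuous_const_rpow (h0 j).ne'
  have hat0 : ∑ j, ρ j ^ (0 : ℝ) = t := by simp
  have ht' : (2 : ℝ) ≤ t := by exact_mod_cast ht
  obtain ⟨s, hs, hs1⟩ := intermediate_value_Icc' hS0 hcont.continuousOn
    (show (1 : ℝ) ∈ Icc _ _ from ⟨hS.le, by rw [hat0]; linarith⟩)
  refine ⟨s, lt_of_le_of_ne hs.1 ?_, hs1⟩
  rintro rfl
  simp only at hs1
  rw [hat0] at hs1
  linarith

theorem hausdorffMeasure_image_of_dist_eq {X Y : Type*} [MetricSpace X] [MeasurableSpace X]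
    [BorelSpace X] [MetricSpace Y] [MeasurableSpace Y] [BorelSpace Y] {f : X → Y} {c s : ℝ}
    (hc : 0 < c) (hs : 0 ≤ s)
    (hf : ∀ x y, dist (f x) (f y) = c * dist x y) (A : Set X) :
    μH[s] (f '' A) = ENNReal.ofReal (c ^ s) * μH[s] A := by
  have hlip : LipschitzWith (Real.toNNReal c) f := LipschitzWith.of_dist_le_mul fun x y => by
    rw [Real.coe_toNNReal c hc.le, hf]
  have hanti : AntilipschitzWith (Real.toNNReal c⁻¹) f :=
    AntilipschitzWith.of_le_mul_dist fun x y => by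
      rw [Real.coe_toNNReal _ (inv_nonneg.2 hc.le), hf, inv_mul_cancel_left₀ hc.ne']
  have e1 : ((Real.toNNReal c : NNReal) : ENNReal) ^ s = ENNReal.ofReal (c ^ s) :=
    ENNReal.ofReal_rpow_of_pos hc
  have e2 : ((Real.toNNReal c⁻¹ : NNReal) : ENNReal) ^ s = ENNReal.ofReal (c⁻¹ ^ s) :=
    ENNReal.ofReal_rpow_of_pos (inv_pos.2 hc)
  refine le_antisymm (e1 ▸ hlip.hausdorffMeasure_image_le hs A) ?_
  have h2 := e2 ▸ hanti.le_hausdorffMeasure_image hs A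
  calc ENNReal.ofReal (c ^ s) * μH[s] A
      ≤ ENNReal.ofReal (c ^ s) * (ENNReal.ofReal (c⁻¹ ^ s) * μH[s] (f '' A)) := by gcongr
    _ = μH[s] (f '' A) := by
      rw [← mul_assoc, ← ENNReal.ofReal_mul (by positivity), ← Real.mul_rpow hc.le (by positivity),
        mul_inv_cancel₀ hc.ne', Real.one_rpow, ENNReal.ofReal_one, one_mul]

/-! ### Finite and positive Hausdorff measure of `F`. -/

section SelfSimilar

variable {d t : ℕ} {g : Fin t → EuclideanSpace ℝ (Fin d) → EuclideanSpace ℝ (Fin d)}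
  {ρ : Fin t → ℝ} {F : Set (EuclideanSpace ℝ (Fin d))}

namespace IsSelfSimilarSet

theorem dist_wordMap (hF : IsSelfSimilarSet g ρ F) (w : List (Fin t))
    (x y : EuclideanSpace ℝ (Fin d)) :
    dist (wordMap g w x) (wordMap g w y) = wordProd ρ w * dist x y := by
  induction w with
  | nil => simp [wordMap]
  | cons j w ih =>
    rw [wordMap, Function.comp, Function.comp, hF.similitude, ih, wordProd_cons, mul_assoc]

theorem continuous_wordMap (hF : IsSelfSimilarSet g ρ F) (w : List (Fin t)) :
    Continuous (wordMap g w) :=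
  (LipschitzWith.of_dist_le_mul (K := (wordProd ρ w).toNNReal) fun x y => by
    rw [hF.dist_wordMap, Real.coe_toNNReal _ (wordProd_pos hF.ratio_pos w).le]).continuous

theorem injective_wordMap (hF : IsSelfSimilarSet g ρ F) (w : List (Fin t)) :
    Function.Injective (wordMap g w) := fun x y hxy => by
  have h := hF.dist_wordMap w x y
  rw [hxy, dist_self] at h
  exact dist_eq_zero.1
    ((mul_eq_zero.1 h.symm).resolve_left (wordProd_pos hF.ratio_pos w).ne')

theorem image_subset (hF : IsSelfSimilarSet g ρ F) (j : Fin t) : g j '' F ⊆ F := by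
  conv_rhs => rw [hF.eq_iUnion]
  exact subset_iUnion (fun j => g j '' F) j

theorem wordMap_image_subset (hF : IsSelfSimilarSet g ρ F) (w : List (Fin t)) :
    wordMap g w '' F ⊆ F := by
  induction w with
  | nil => simp [wordMap]
  | cons j w ih =>
    rw [wordMap, image_comp]
    exact (image_mono ih).trans (hF.image_subset j)

theorem wordMap_image_eq_iUnion (hF : IsSelfSimilarSet g ρ F) (w : List (Fin t)) :
    wordMap g w '' F = ⋃ j, wordMap g (w ++ [j]) '' F := by
  conv_lhs => rw [hF.eq_iUnion, image_iUnion]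
  refine iUnion_congr fun j => ?_
  rw [wordMap_append, image_comp]; rfl

theorem isCompact_wordMap_image (hF : IsSelfSimilarSet g ρ F) (w : List (Fin t)) :
    IsCompact (wordMap g w '' F) := hF.isCompact.image (hF.continuous_wordMap w)

theorem ediam_wordMap_image_le (hF : IsSelfSimilarSet g ρ F) (w : List (Fin t)) :
    Metric.ediam (wordMap g w '' F) ≤ ENNReal.ofReal (wordProd ρ w * Metric.diam F) := by
  refine Metric.ediam_le ?_
  rintro _ ⟨x, hx, rfl⟩ _ ⟨y, hy, rfl⟩
  rw [edist_dist, hF.dist_wordMap]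
  have := (wordProd_pos hF.ratio_pos w).le
  have := Metric.dist_le_diam_of_mem hF.isCompact.isBounded hx hy
  gcongr

theorem exists_ratio_le (hF : IsSelfSimilarSet g ρ F) : ∃ q, 0 < q ∧ q < 1 ∧ ∀ j, ρ j ≤ q := by
  rcases isEmpty_or_nonempty (Fin t) with h | h
  · exact ⟨1 / 2, by norm_num, by norm_num, fun j => h.elim j⟩
  · obtain ⟨j, hj⟩ := Finite.exists_max ρ
    exact ⟨ρ j, hF.ratio_pos j, hF.ratio_lt_one j, hj⟩

theorem nonempty_index (hF : IsSelfSimilarSet g ρ F) : Nonempty (Fin t) := by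
  obtain ⟨x, hx⟩ := hF.nonempty
  rw [hF.eq_iUnion, mem_iUnion] at hx
  exact ⟨hx.choose⟩

/-- The level `k` cylinders cover `F`, and their `s`-sum of diameters is at most `diam F ^ s` for
every `k`. -/
theorem hausdorffMeasure_lt_top (hF : IsSelfSimilarSet g ρ F) {s : ℝ} (hs : 0 < s)
    (hsum : ∑ j, ρ j ^ s = 1) : μH[s] F < ⊤ := by
  obtain ⟨q, hq0, hq1, hq⟩ := hF.exists_ratio_le
  have hcov : ∀ k : ℕ, F ⊆ ⋃ v : Fin k → Fin t, wordMap g (List.ofFn v) '' F := by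
    intro k
    induction k with
    | zero => intro x hx; simpa [wordMap] using hx
    | succ k ih =>
      intro x hx
      obtain ⟨v, hv⟩ := mem_iUnion.1 (ih hx)
      rw [hF.wordMap_image_eq_iUnion] at hv
      obtain ⟨j, hj⟩ := mem_iUnion.1 hv
      refine mem_iUnion.2 ⟨Fin.snoc v j, ?_⟩
      rw [List.ofFn_succ']
      simpa using hj
  have hdiam : Tendsto (fun k : ℕ => ENNReal.ofReal (q ^ k * Metric.diam F)) atTop (𝓝 0) := by
    have h := (tendsto_pow_atTop_nhds_zero_of_lt_one hq0.le hq1).mul_const (Metric.diam F)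
    have := ENNReal.tendsto_ofReal h
    simpa using this
  have hle := Measure.hausdorffMeasure_le_liminf_sum s F _ hdiam
    (fun k (v : Fin k → Fin t) => wordMap g (List.ofFn v) '' F)
    (Eventually.of_forall fun k v => by
      refine (hF.ediam_wordMap_image_le _).trans ?_
      have h1 := wordProd_le_pow hF.ratio_pos hq (List.ofFn v)
      rw [List.length_ofFn] at h1
      have := Metric.diam_nonneg (s := F)
      gcongr)
    (Eventually.of_forall hcov)
  refine (hle.trans ?_).trans_lt (ENNReal.ofReal_lt_top (r := Metric.diam F ^ s))
  refine liminf_le_of_le (by isBoundedDefault) fun b hb => ?_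
  obtain ⟨k, hk⟩ := hb.exists
  refine hk.trans ?_
  calc ∑ v : Fin k → Fin t, Metric.ediam (wordMap g (List.ofFn v) '' F) ^ s
      ≤ ∑ v : Fin k → Fin t, ENNReal.ofReal ((∏ i, ρ (v i) ^ s) * Metric.diam F ^ s) := by
        refine Finset.sum_le_sum fun v _ => ?_
        have hpos := wordProd_pos hF.ratio_pos (List.ofFn v)
        refine (ENNReal.rpow_le_rpow (hF.ediam_wordMap_image_le _) hs.le).trans ?_
        rw [ENNReal.ofReal_rpow_of_nonneg (mul_nonneg hpos.le Metric.diam_nonneg) hs.le,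
          Real.mul_rpow hpos.le Metric.diam_nonneg, ← wordProd_rpow hF.ratio_pos]
        simp [wordProd, List.map_ofFn, List.prod_ofFn]
    _ = ENNReal.ofReal (∑ v : Fin k → Fin t, (∏ i, ρ (v i) ^ s) * Metric.diam F ^ s) := by
        rw [ENNReal.ofReal_sum_of_nonneg]
        intro v _
        have : ∀ i, 0 ≤ ρ (v i) ^ s := fun i => Real.rpow_nonneg (hF.ratio_pos _).le _
        exact mul_nonneg (Finset.prod_nonneg fun i _ => this i)
          (Real.rpow_nonneg Metric.diam_nonneg _)
    _ = ENNReal.ofReal (Metric.diam F ^ s) := by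
        rw [← Finset.sum_mul, ← Fintype.sum_pow (fun j => ρ j ^ s), hsum, one_pow, one_mul]

end IsSelfSimilarSet

namespace IsDustLike

/-- The constant is a lower bound for the distances between distinct first-level pieces; a common
first letter is removed by rescaling. -/
theorem exists_separation (hF : IsDustLike g ρ F) :
    ∃ c > 0, ∀ (w : List (Fin t)), ∀ x ∈ wordMap g w '' F, ∀ y ∈ F, y ∉ wordMap g w '' F →
      c * wordProd ρ w ≤ dist x y := by
  have hsep : ∃ c > 0, ∀ i j : Fin t, i ≠ j → ∀ x ∈ g i '' F, ∀ y ∈ g j '' F, c ≤ dist x y := by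
    have hpair : ∀ p : Fin t × Fin t, ∃ c > 0, p.1 ≠ p.2 →
        ∀ x ∈ g p.1 '' F, ∀ y ∈ g p.2 '' F, c ≤ dist x y := by
      rintro ⟨i, j⟩
      by_cases hij : i = j
      · exact ⟨1, one_pos, fun h => absurd hij h⟩
      · have hc := fun k => hF.isCompact_wordMap_image [k]
        obtain ⟨r, hr, h⟩ := Metric.exists_pos_forall_lt_edist (hc i) (hc j).isClosed
          (disjoint_iff_inter_eq_empty.2 (hF.separated i j hij))
        refine ⟨r, hr, fun _ x hx y hy => ?_⟩
        have := h x hx y hy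
        rw [edist_nndist, ENNReal.coe_lt_coe] at this
        exact_mod_cast this.le
    choose c hc h using hpair
    obtain ⟨η, hη, hmin⟩ := (Set.finite_range c).exists_pos_le_of_pos
    exact ⟨η, hη, fun i j hij x hx y hy =>
      (hmin _ ⟨(i, j), rfl⟩ (hc _)).trans (h (i, j) hij x hx y hy)⟩
  obtain ⟨c, hc, hsep⟩ := hsep
  refine ⟨c, hc, fun w => ?_⟩
  obtain ⟨q, hq0, hq1, hq⟩ := hF.exists_ratio_le
  induction w with
  | nil => intro x _ y hy hy'; exact absurd (by simpa [wordMap] using hy) hy'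
  | cons j w ih =>
    rintro x hx y hyF hy'
    rw [wordMap, image_comp] at hx hy'
    obtain ⟨x, hx, rfl⟩ := hx
    obtain ⟨i, hi⟩ := mem_iUnion.1 (hF.eq_iUnion.subset hyF)
    by_cases hij : j = i
    · subst hij
      obtain ⟨y, hy, rfl⟩ := hi
      have := ih x hx y hy fun hmem => hy' ⟨y, hmem, rfl⟩
      rw [hF.similitude, wordProd_cons]
      have := mul_le_mul_of_nonneg_left this (hF.ratio_pos j).le
      linarith
    · refine le_trans ?_ (hsep j i hij _ ⟨x, hF.wordMap_image_subset w hx, rfl⟩ y hi)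
      refine mul_le_of_le_one_right hc.le ((wordProd_le_pow hF.ratio_pos hq _).trans ?_)
      exact pow_le_one₀ hq0.le hq1.le

theorem disjoint_children (hF : IsDustLike g ρ F) (w : List (Fin t)) :
    Pairwise (Function.onFun Disjoint fun j => wordMap g (w ++ [j]) '' F) := by
  intro i j hij
  simp only [Function.onFun, wordMap_append, image_comp]
  rw [disjoint_image_iff (hF.injective_wordMap w), disjoint_iff_inter_eq_empty]
  exact hF.separated i j hij

/-- Finitely many cylinders covering `F` have total weight at least one. -/
theorem one_le_sum_of_cover (hF : IsDustLike g ρ F) {s : ℝ} (hsum : ∑ j, ρ j ^ s = 1) {ι : Type*}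
    (L : ℕ) (I : Finset ι) (w : ι → List (Fin t)) (hlen : ∀ i ∈ I, (w i).length ≤ L)
    (hcov : F ⊆ ⋃ i ∈ I, wordMap g (w i) '' F) : 1 ≤ ∑ i ∈ I, wordProd ρ (w i) ^ s := by
  have hnn : ∀ i, 0 ≤ wordProd ρ (w i) ^ s :=
    fun i => Real.rpow_nonneg (wordProd_pos hF.ratio_pos _).le _
  by_cases hnil : ∃ i ∈ I, w i = []
  · obtain ⟨i, hi, hw⟩ := hnil
    refine le_trans (by simp [hw]) (Finset.single_le_sum (fun i _ => hnn i) hi)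
  push Not at hnil
  induction L generalizing I w with
  | zero =>
    obtain ⟨x, hx⟩ := hF.nonempty
    obtain ⟨i, hi, -⟩ := mem_iUnion₂.1 (hcov hx)
    exact absurd (List.eq_nil_of_length_eq_zero (by simpa using hlen i hi)) (hnil i hi)
  | succ L ih =>
    have hsplit : ∑ j : Fin t, ∑ i ∈ I with (w i).head? = some j, wordProd ρ (w i) ^ s ≤
        ∑ i ∈ I, wordProd ρ (w i) ^ s := by
      rw [← Finset.sum_fiberwise I (fun i => (w i).head?), Fintype.sum_option]
      exact le_add_of_nonneg_left (Finset.sum_nonneg fun i _ => hnn i)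
    refine le_trans ?_ hsplit
    rw [← hsum]
    refine Finset.sum_le_sum fun j _ => ?_
    have hw : ∀ i ∈ I.filter (fun i => (w i).head? = some j), w i = j :: (w i).tail := by
      intro i hi
      exact (List.cons_head?_tail (by simpa using (Finset.mem_filter.1 hi).2)).symm
    have hone : 1 ≤ ∑ i ∈ I with (w i).head? = some j, wordProd ρ (w i).tail ^ s := by
      have hnn' : ∀ i, 0 ≤ wordProd ρ (w i).tail ^ s :=
        fun i => Real.rpow_nonneg (wordProd_pos hF.ratio_pos _).le _
      have hcov' : F ⊆ ⋃ i ∈ I.filter (fun i => (w i).head? = some j),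
          wordMap g (w i).tail '' F := by
        intro x hx
        obtain ⟨i, hi, hxi⟩ := mem_iUnion₂.1 (hcov (hF.image_subset j ⟨x, hx, rfl⟩))
        obtain ⟨k, v, hkv⟩ := List.exists_cons_of_ne_nil (hnil i hi)
        rw [hkv, wordMap, image_comp] at hxi
        obtain ⟨y, hy, hyx⟩ := hxi
        have hkj : k = j := by
          by_contra hne
          have := hF.separated k j hne
          exact (this ▸ (⟨⟨y, hF.wordMap_image_subset v hy, hyx⟩, ⟨x, hx, rfl⟩⟩ :
            g j x ∈ g k '' F ∩ g j '' F) : g j x ∈ (∅ : Set _))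
        subst hkj
        have hxy : y = x := hF.injective_wordMap [k] hyx
        refine mem_iUnion₂.2 ⟨i, Finset.mem_filter.2 ⟨hi, by simp [hkv]⟩, ?_⟩
        rw [hkv, List.tail_cons, ← hxy]
        exact hy
      by_cases hnil' : ∃ i ∈ I.filter (fun i => (w i).head? = some j), (w i).tail = []
      · obtain ⟨i, hi, hwi⟩ := hnil'
        exact le_trans (by simp [hwi]) (Finset.single_le_sum (fun i _ => hnn' i) hi)
      · push Not at hnil'
        refine ih _ (fun i => (w i).tail) ?_ hcov' hnn' hnil'
        intro i hi
        have := hlen i (Finset.mem_filter.1 hi).1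
        rw [List.length_tail]; omega
    calc ρ j ^ s ≤ ρ j ^ s * ∑ i ∈ I with (w i).head? = some j, wordProd ρ (w i).tail ^ s :=
          le_mul_of_one_le_right (Real.rpow_nonneg (hF.ratio_pos j).le _) hone
      _ = ∑ i ∈ I with (w i).head? = some j, wordProd ρ (w i) ^ s := by
          rw [Finset.mul_sum]
          refine Finset.sum_congr rfl fun i hi => ?_
          conv_rhs => rw [hw i hi, wordProd_cons,
            Real.mul_rpow (hF.ratio_pos j).le (wordProd_pos hF.ratio_pos _).le]

/-- The least weight of a cylinder containing a given part of `F`. -/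
noncomputable def cylinderContent
    (g : Fin t → EuclideanSpace ℝ (Fin d) → EuclideanSpace ℝ (Fin d))
    (ρ : Fin t → ℝ) (F : Set (EuclideanSpace ℝ (Fin d))) (s : ℝ)
    (U : Set (EuclideanSpace ℝ (Fin d))) : ENNReal :=
  ⨅ (w : List (Fin t)) (_ : U ∩ F ⊆ wordMap g w '' F), ENNReal.ofReal (wordProd ρ w ^ s)

/-- If some cylinder contains `U ∩ F` but none of its children does, then `U` has points on both
sides of a child, and separation bounds its diameter below. Otherwise arbitrarily small cylinders
contain `U ∩ F` and the content vanishes. -/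
theorem cylinderContent_le (hF : IsDustLike g ρ F) {s : ℝ} (hs : 0 < s) :
    ∃ K : ENNReal, K ≠ 0 ∧ K ≠ ⊤ ∧ ∀ U, cylinderContent g ρ F s U ≤ K * Metric.ediam U ^ s := by
  obtain ⟨c, hc, hsep⟩ := hF.exists_separation
  obtain ⟨q, hq0, hq1, hq⟩ := hF.exists_ratio_le
  obtain ⟨η, hη, hmin⟩ := (Set.finite_range ρ).exists_pos_le_of_pos
  have hK : 0 < (c * η)⁻¹ ^ s := by positivity
  refine ⟨ENNReal.ofReal ((c * η)⁻¹ ^ s), by simpa using hK, ENNReal.ofReal_ne_top,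
    fun U => ?_⟩
  by_cases h : ∀ w, U ∩ F ⊆ wordMap g w '' F → ∃ j, U ∩ F ⊆ wordMap g (w ++ [j]) '' F
  · have hdeep : ∀ N : ℕ, ∃ w : List (Fin t), w.length = N ∧ U ∩ F ⊆ wordMap g w '' F := by
      intro N
      induction N with
      | zero => exact ⟨[], rfl, by simp [wordMap]⟩
      | succ N ih =>
        obtain ⟨w, rfl, hw⟩ := ih
        obtain ⟨j, hj⟩ := h w hw
        exact ⟨w ++ [j], by simp, hj⟩
    have hle : ∀ N : ℕ, cylinderContent g ρ F s U ≤ ENNReal.ofReal ((q ^ s) ^ N) := by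
      intro N
      obtain ⟨w, rfl, hw⟩ := hdeep N
      refine (iInf₂_le w hw).trans (ENNReal.ofReal_le_ofReal ?_)
      rw [← wordProd_rpow hF.ratio_pos]
      exact wordProd_le_pow (fun j => Real.rpow_pos_of_pos (hF.ratio_pos j) _)
        (fun j => Real.rpow_le_rpow (hF.ratio_pos j).le (hq j) hs.le) w
    have hlim : Tendsto (fun N : ℕ => ENNReal.ofReal ((q ^ s) ^ N)) atTop (𝓝 0) := by
      have := ENNReal.tendsto_ofReal (tendsto_pow_atTop_nhds_zero_of_lt_one
        (Real.rpow_nonneg hq0.le s) (Real.rpow_lt_one hq0.le hq1 hs))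
      simpa using this
    exact (ge_of_tendsto' hlim hle).trans zero_le
  · push Not at h
    obtain ⟨w, hw, hj⟩ := h
    have hne : (U ∩ F).Nonempty := by
      obtain ⟨j⟩ := hF.nonempty_index
      obtain ⟨y, hy, -⟩ := not_subset.1 (hj j)
      exact ⟨y, hy⟩
    obtain ⟨x, hx⟩ := hne
    have hxw := hw hx
    rw [hF.wordMap_image_eq_iUnion] at hxw
    obtain ⟨j, hxj⟩ := mem_iUnion.1 hxw
    obtain ⟨y, hy, hyj⟩ := not_subset.1 (hj j)
    have hdist := hsep _ x hxj y hy.2 hyj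
    have hpos := wordProd_pos hF.ratio_pos w
    have hed : ENNReal.ofReal (c * η * wordProd ρ w) ≤ Metric.ediam U := by
      refine le_trans ?_ (Metric.edist_le_ediam_of_mem hx.1 hy.1)
      rw [edist_dist]
      refine ENNReal.ofReal_le_ofReal (le_trans ?_ hdist)
      rw [wordProd_append, wordProd_cons, wordProd_nil, mul_one, mul_assoc,
        mul_comm (wordProd ρ w)]
      have := hmin _ ⟨j, rfl⟩ (hF.ratio_pos j)
      gcongr
    refine (iInf₂_le w hw).trans ?_
    calc ENNReal.ofReal (wordProd ρ w ^ s)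
        = ENNReal.ofReal ((c * η)⁻¹ ^ s) * ENNReal.ofReal (c * η * wordProd ρ w) ^ s := by
          rw [ENNReal.ofReal_rpow_of_pos (by positivity), ← ENNReal.ofReal_mul hK.le,
            ← Real.mul_rpow (by positivity) (by positivity),
            inv_mul_cancel_left₀ (by positivity)]
      _ ≤ _ := by gcongr

theorem one_le_tsum_cylinderContent (hF : IsDustLike g ρ F) {s : ℝ}
    (hsum : ∑ j, ρ j ^ s = 1) (U : ℕ → Set (EuclideanSpace ℝ (Fin d))) (hU : F ⊆ ⋃ k, U k) :
    1 ≤ ∑' k, cylinderContent g ρ F s (U k) := by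
  obtain ⟨c, hc, hsep⟩ := hF.exists_separation
  by_cases htop : ∃ k, cylinderContent g ρ F s (U k) = ⊤
  · rw [ENNReal.tsum_eq_top_of_eq_top htop]; exact le_top
  push Not at htop
  refine ENNReal.le_of_forall_pos_le_add fun ε hε _ => ?_
  obtain ⟨δ, hδ, hδsum⟩ := ENNReal.exists_pos_sum_of_countable
    (ENNReal.coe_ne_zero.2 hε.ne') ℕ
  have hch : ∀ k, ∃ w : List (Fin t), U k ∩ F ⊆ wordMap g w '' F ∧
      ENNReal.ofReal (wordProd ρ w ^ s) < cylinderContent g ρ F s (U k) + δ k := by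
    intro k
    have hlt : cylinderContent g ρ F s (U k) < cylinderContent g ρ F s (U k) + δ k :=
      ENNReal.lt_add_right (htop k) (ENNReal.coe_ne_zero.2 (hδ k).ne')
    conv_lhs at hlt => rw [cylinderContent]
    obtain ⟨w, hw⟩ := iInf_lt_iff.1 hlt
    obtain ⟨hw1, hw2⟩ := iInf_lt_iff.1 hw
    exact ⟨w, hw1, hw2⟩
  choose w hwU hwlt using hch
  -- Thickening a cylinder by its separation distance gives an open set that meets `F` only in that
  -- cylinder, so a finite subcover of thickenings is a finite cover by cylinders.
  obtain ⟨I, hI⟩ := hF.isCompact.elim_finite_subcover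
    (fun k => Metric.thickening (c * wordProd ρ (w k)) (wordMap g (w k) '' F))
    (fun k => Metric.isOpen_thickening) (by
      intro x hx
      obtain ⟨k, hk⟩ := mem_iUnion.1 (hU hx)
      exact mem_iUnion.2 ⟨k, Metric.self_subset_thickening
        (mul_pos hc (wordProd_pos hF.ratio_pos _)) _ (hwU k ⟨hk, hx⟩)⟩)
  have hcov : F ⊆ ⋃ k ∈ I, wordMap g (w k) '' F := by
    intro x hx
    obtain ⟨k, hk, hxk⟩ := mem_iUnion₂.1 (hI hx)
    refine mem_iUnion₂.2 ⟨k, hk, ?_⟩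
    by_contra hcon
    obtain ⟨y, hy, hxy⟩ := Metric.mem_thickening_iff.1 hxk
    have := hsep _ y hy x hx hcon
    rw [dist_comm] at this
    linarith
  have h1 := hF.one_le_sum_of_cover hsum (I.sup fun k => (w k).length) I w
    (fun i hi => Finset.le_sup (f := fun k => (w k).length) hi) hcov
  calc (1 : ENNReal) = ENNReal.ofReal 1 := ENNReal.ofReal_one.symm
    _ ≤ ENNReal.ofReal (∑ k ∈ I, wordProd ρ (w k) ^ s) := ENNReal.ofReal_le_ofReal h1
    _ = ∑ k ∈ I, ENNReal.ofReal (wordProd ρ (w k) ^ s) :=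
        ENNReal.ofReal_sum_of_nonneg fun i _ =>
          Real.rpow_nonneg (wordProd_pos hF.ratio_pos _).le _
    _ ≤ ∑' k, ENNReal.ofReal (wordProd ρ (w k) ^ s) := ENNReal.sum_le_tsum I
    _ ≤ ∑' k, (cylinderContent g ρ F s (U k) + δ k) := ENNReal.tsum_le_tsum fun k => (hwlt k).le
    _ = ∑' k, cylinderContent g ρ F s (U k) + ∑' k, (δ k : ENNReal) := ENNReal.tsum_add
    _ ≤ _ := by gcongr

/-- The outer measure generated by `cylinderContent` is at least `1` on `F` and at most a constant
times `μH[s]`. -/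
theorem hausdorffMeasure_pos (hF : IsDustLike g ρ F) {s : ℝ} (hs : 0 < s)
    (hsum : ∑ j, ρ j ^ s = 1) : 0 < μH[s] F := by
  obtain ⟨K, hK0, hKtop, hK⟩ := hF.cylinderContent_le hs
  have hempty : cylinderContent g ρ F s ∅ = 0 := by
    have := hK ∅
    simpa [ENNReal.zero_rpow_of_pos hs] using this
  have hle : OuterMeasure.ofFunction (cylinderContent g ρ F s) hempty ≤
      OuterMeasure.mkMetric (K • fun x : ENNReal => x ^ s) :=
    OuterMeasure.le_mkMetric _ _ 1 one_pos fun U _ =>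
      (OuterMeasure.ofFunction_le U).trans (hK U)
  have h1 : 1 ≤ OuterMeasure.ofFunction (cylinderContent g ρ F s) hempty F := by
    rw [OuterMeasure.ofFunction_apply]
    exact le_iInf₂ fun U hU => hF.one_le_tsum_cylinderContent hsum U hU
  have h2 := h1.trans (hle F)
  rw [OuterMeasure.mkMetric_smul _ hKtop hK0, smul_apply,
    OuterMeasure.coe_mkMetric] at h2
  change 1 ≤ K • μH[s] F at h2
  rw [pos_iff_ne_zero]
  intro h0
  rw [h0, smul_zero] at h2
  exact absurd h2 (by simp)

end IsDustLike

end SelfSimilar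

/-! ### Commensurability of the ratios with `lam`. -/

theorem eventually_eq_of_tendsto_of_finite {α : Type*} {l : Filter α} {u : α → ℝ} {x : ℝ}
    {Q : Set ℝ} (hQ : Q.Finite) (hu : Tendsto u l (𝓝 x)) (hmem : ∀ k, u k ∈ Q) :
    ∀ᶠ k in l, u k = x := by
  have hopen : (Q \ {x})ᶜ ∈ 𝓝 x :=
    (hQ.subset sdiff_subset).isClosed.isOpen_compl.mem_nhds (by simp)
  filter_upwards [hu.eventually hopen] with k hk
  by_contra hne
  exact hk ⟨hmem k, hne⟩

theorem finite_zpow_mem_Icc {lam : ℝ} (h0 : 0 < lam) (h1 : lam < 1) {α β : ℝ} (hα : 0 < α) :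
    {z : ℤ | lam ^ z ∈ Icc α β}.Finite := by
  have hlog : Real.log lam < 0 := Real.log_neg h0 h1
  refine (Set.finite_Icc ⌈Real.log β / Real.log lam⌉ ⌊Real.log α / Real.log lam⌋).subset ?_
  rintro z ⟨hz1, hz2⟩
  have l1 := Real.log_le_log hα hz1
  have l2 := Real.log_le_log (zpow_pos h0 z) hz2
  rw [Real.log_zpow] at l1 l2
  exact ⟨Int.ceil_le.2 ((div_le_iff_of_neg hlog).2 l2),
    Int.le_floor.2 ((le_div_iff_of_neg hlog).2 l1)⟩

/-- A sequence of words along which `a / wordProd p` tends to its supremum can be prolonged by any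
fixed letter. -/
theorem tendsto_append_letter {t : ℕ} {p : Fin t → ℝ} (hp : ∀ j, 0 < p j) (hsum : ∑ j, p j = 1)
    {a : List (Fin t) → ℝ} (hadd : ∀ w, a w = ∑ j, a (w ++ [j])) {M : ℝ}
    (hM : ∀ w, a w / wordProd p w ≤ M) {u : ℕ → List (Fin t)}
    (hu : Tendsto (fun k => a (u k) / wordProd p (u k)) atTop (𝓝 M)) (j : Fin t) :
    Tendsto (fun k => a (u k ++ [j]) / wordProd p (u k ++ [j])) atTop (𝓝 M) := by
  -- The deficit `M - a w / wordProd p w` is the `p`-weighted average of the nonnegative deficits of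
  -- the children, so no child's deficit exceeds the parent's divided by `p j`.
  have hlow : ∀ w, M - (M - a w / wordProd p w) / p j ≤
      a (w ++ [j]) / wordProd p (w ++ [j]) := by
    intro w
    have hw := wordProd_pos hp w
    have e1 : a w / wordProd p w =
        ∑ i, p i * (a (w ++ [i]) / wordProd p (w ++ [i])) := by
      rw [hadd w, Finset.sum_div]
      refine Finset.sum_congr rfl fun i _ => ?_
      have := (hp i).ne'
      simp only [wordProd_append, wordProd_cons, wordProd_nil, mul_one]
      field_simp
    have e2 : M - a w / wordProd p w =
        ∑ i, p i * (M - a (w ++ [i]) / wordProd p (w ++ [i])) := by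
      simp only [mul_sub, Finset.sum_sub_distrib, ← Finset.sum_mul, hsum, one_mul, e1]
    have e3 : p j * (M - a (w ++ [j]) / wordProd p (w ++ [j])) ≤ M - a w / wordProd p w := by
      rw [e2]
      exact Finset.single_le_sum
        (f := fun i => p i * (M - a (w ++ [i]) / wordProd p (w ++ [i])))
        (fun i _ => mul_nonneg (hp i).le (sub_nonneg.2 (hM _))) (Finset.mem_univ j)
    rw [sub_le_comm, le_div_iff₀ (hp j)]
    linarith
  refine tendsto_of_tendsto_of_tendsto_of_le_of_le ?_ tendsto_const_nhds
    (fun k => hlow (u k)) (fun k => hM _)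
  simpa using (tendsto_const_nhds (x := M)).sub
    (((tendsto_const_nhds (x := M)).sub hu).div_const (p j))

/-- If an additive function on words is comparable to `wordProd ρ ^ s` and takes finitely many
values up to powers of `lam ^ s`, then the ratios are rationally related to `lam`. -/
theorem exists_pow_eq_pow_of_finite_values {t : ℕ} {ρ : Fin t → ℝ} (hρ0 : ∀ j, 0 < ρ j)
    (hρ1 : ∀ j, ρ j < 1) {s : ℝ} (hs : 0 < s) (hsum : ∑ j, ρ j ^ s = 1) {lam : ℝ} (hl0 : 0 < lam)
    (hl1 : lam < 1) {a : List (Fin t) → ℝ} (hpos : ∀ w, 0 < a w)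
    (hadd : ∀ w, a w = ∑ j, a (w ++ [j])) {K : ℝ} (hK : ∀ w, a w ≤ K * wordProd ρ w ^ s)
    {κ κ' : ℝ} (hκ : 0 < κ) {V : Set ℝ} (hV : V.Finite)
    (hval : ∀ w, ∃ N : ℕ, κ * wordProd ρ w ≤ lam ^ N ∧ lam ^ N ≤ κ' * wordProd ρ w ∧
      ∃ v ∈ V, a w = (lam ^ N) ^ s * v) (j : Fin t) :
    ∃ p q : ℕ, 0 < p ∧ 0 < q ∧ ρ j ^ p = lam ^ q := by
  set P : Fin t → ℝ := fun j => ρ j ^ s with hP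
  have hP0 : ∀ j, 0 < P j := fun j => Real.rpow_pos_of_pos (hρ0 j) s
  have hPw : ∀ w, wordProd P w = wordProd ρ w ^ s := wordProd_rpow hρ0 s
  have hPpos := wordProd_pos hP0
  have hρpos := wordProd_pos hρ0
  choose N hN1 hN2 v hv hav using hval
  have hbdd : BddAbove (range fun w => a w / wordProd P w) := by
    refine ⟨K, ?_⟩
    rintro _ ⟨w, rfl⟩
    rw [div_le_iff₀ (hPpos w), hPw]
    exact hK w
  set M := sSup (range fun w => a w / wordProd P w) with hMdef
  have hM : ∀ w, a w / wordProd P w ≤ M := fun w => le_csSup hbdd ⟨w, rfl⟩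
  have hM0 : 0 < M := (div_pos (hpos []) (hPpos [])).trans_le (hM [])
  obtain ⟨x, -, hxlim, hxmem⟩ := exists_seq_tendsto_sSup (range_nonempty _) hbdd
  choose u hu using hxmem
  have hu0 : Tendsto (fun k => a (u k) / wordProd P (u k)) atTop (𝓝 M) := by
    simpa only [hu] using hxlim
  have hul : ∀ l : ℕ, Tendsto (fun k => a (u k ++ List.replicate l j) /
      wordProd P (u k ++ List.replicate l j)) atTop (𝓝 M) := by
    intro l
    induction l with
    | zero => simpa using hu0
    | succ l ih =>
      have := tendsto_append_letter hP0 hsum hadd hM ih j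
      simpa only [List.append_assoc, ← List.replicate_succ'] using this
  have hratio : ∀ l : ℕ, Tendsto (fun k => a (u k ++ List.replicate l j) / a (u k)) atTop
      (𝓝 (P j ^ l)) := by
    intro l
    have h := ((hul l).div hu0 hM0.ne').mul_const (P j ^ l)
    rw [div_self hM0.ne', one_mul] at h
    refine h.congr fun k => ?_
    have h1 := (hPpos (u k)).ne'
    have h2 := (hpos (u k)).ne'
    have h3 := (hP0 j).ne'
    simp only [Pi.div_apply, wordProd_append, wordProd_replicate]
    field_simp
  have hκ' : 0 < κ' :=
    pos_of_mul_pos_left ((mul_pos hκ (hρpos [])).trans_le ((hN1 []).trans (hN2 []))) (hρpos []).le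
  have hfin : ∀ l : ℕ, ∀ᶠ k in atTop, a (u k ++ List.replicate l j) / a (u k) = P j ^ l := by
    intro l
    -- `Z` contains the possible differences of levels between `u k` followed by `l` letters `j` and
    -- `u k` itself; the bounds do not depend on `k`.
    set Z : Set ℤ := {z : ℤ | lam ^ z ∈ Icc (κ * ρ j ^ l / κ') (κ' * ρ j ^ l / κ)} with hZ
    have hZfin : Z.Finite := finite_zpow_mem_Icc hl0 hl1 (by have := hρ0 j; positivity)
    refine eventually_eq_of_tendsto_of_finite
      (((hZfin.prod (hV.prod hV)).image
        fun q : ℤ × ℝ × ℝ => (lam ^ q.1) ^ s * q.2.1 / q.2.2)) (hratio l) fun k => ?_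
    set w' := u k ++ List.replicate l j with hw'
    have hwp : wordProd ρ w' = wordProd ρ (u k) * ρ j ^ l := by
      rw [hw', wordProd_append, wordProd_replicate]
    have hz : lam ^ ((N w' : ℤ) - N (u k)) = lam ^ N w' / lam ^ N (u k) := by
      rw [zpow_sub₀ hl0.ne', zpow_natCast, zpow_natCast]
    refine ⟨((N w' : ℤ) - N (u k), v w', v (u k)), ⟨?_, hv _, hv _⟩, ?_⟩
    · have hr := hρpos (u k)
      have hj := pow_pos (hρ0 j) l
      have hd := pow_pos hl0 (N (u k))
      have a1 := hN1 w'
      have a2 := hN2 w'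
      rw [hwp] at a1 a2
      simp only [hZ, mem_ofPred_eq, hz, mem_Icc]
      constructor
      · rw [div_le_div_iff₀ hκ' hd]
        calc κ * ρ j ^ l * lam ^ N (u k)
            ≤ κ * ρ j ^ l * (κ' * wordProd ρ (u k)) := by gcongr; exact hN2 _
          _ = κ * (wordProd ρ (u k) * ρ j ^ l) * κ' := by ring
          _ ≤ _ := by gcongr
      · rw [div_le_div_iff₀ hd hκ]
        calc lam ^ N w' * κ ≤ κ' * (wordProd ρ (u k) * ρ j ^ l) * κ := by gcongr
          _ = κ' * ρ j ^ l * (κ * wordProd ρ (u k)) := by ring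
          _ ≤ _ := by gcongr; exact hN1 _
    · simp only [hz]
      rw [hav w', hav (u k), Real.div_rpow (by positivity) (by positivity)]
      have := (Real.rpow_pos_of_pos (pow_pos hl0 (N (u k))) s).ne'
      rw [div_mul_eq_mul_div, div_div]
  -- One `k` serves all `l ≤ |V|`; these are more exponents than values in `V`, so two of them share
  -- the same `v`.
  obtain ⟨k, hk⟩ := ((eventually_all_finset (Finset.range (hV.toFinset.card + 1))).2
    fun l _ => hfin l).exists
  obtain ⟨l, hl, l', hl', hne, heq⟩ := Finset.exists_ne_map_eq_of_card_lt_of_maps_to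
    (s := Finset.range (hV.toFinset.card + 1)) (t := hV.toFinset)
    (f := fun l => v (u k ++ List.replicate l j)) (by simp) (fun l _ => by simpa using hv _)
  wlog hlt : l < l' generalizing l l'
  · exact this l' hl' l hl hne.symm heq.symm (by omega)
  have e1 := hk l hl
  have e2 := hk l' hl'
  set w := u k ++ List.replicate l j
  set w' := u k ++ List.replicate l' j
  rw [div_eq_iff (hpos _).ne', hav] at e1 e2
  have hvpos : 0 < v w := by
    have h := hpos w
    rw [hav] at h
    exact pos_of_mul_pos_right h (by positivity)
  have hPl := pow_pos (hP0 j) l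
  have hak := hpos (u k)
  have e3 : (lam ^ N w') ^ s = P j ^ (l' - l) * (lam ^ N w) ^ s := by
    have : P j ^ l' = P j ^ (l' - l) * P j ^ l := by rw [← pow_add, Nat.sub_add_cancel hlt.le]
    rw [this, mul_assoc, ← e1, ← heq, ← mul_assoc] at e2
    exact mul_right_cancel₀ hvpos.ne' e2
  have e4 : lam ^ N w' = ρ j ^ (l' - l) * lam ^ N w := by
    have h5 : P j ^ (l' - l) = (ρ j ^ (l' - l)) ^ s := by
      rw [hP, ← Real.rpow_natCast, ← Real.rpow_natCast, ← Real.rpow_mul (hρ0 j).le,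
        ← Real.rpow_mul (hρ0 j).le, mul_comm]
    have hj := (pow_pos (hρ0 j) (l' - l)).le
    rw [h5, ← Real.mul_rpow hj (by positivity)] at e3
    exact (Real.rpow_left_inj (by positivity) (mul_nonneg hj (by positivity)) hs.ne').1 e3
  have hlt1 : ρ j ^ (l' - l) < 1 := pow_lt_one₀ (hρ0 j).le (hρ1 j) (by omega)
  have hNlt : N w < N w' := by
    rw [← pow_lt_pow_iff_right_of_lt_one₀ hl0 hl1, e4]
    exact mul_lt_of_lt_one_left (by positivity) hlt1
  refine ⟨l' - l, N w' - N w, by omega, by omega, ?_⟩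
  have : lam ^ N w' = lam ^ (N w' - N w) * lam ^ N w := by
    rw [← pow_add, Nat.sub_add_cancel hNlt.le]
  rw [this] at e4
  exact (mul_right_cancel₀ (pow_pos hl0 _).ne' e4).symm

/-- Pairwise commensurability with `lam` yields a common root, after sorting the exponents. -/
theorem exists_common_root {t : ℕ} {ρ : Fin t → ℝ} (hρ0 : ∀ j, 0 < ρ j) {lam : ℝ}
    (hl0 : 0 < lam) (hl1 : lam < 1)
    (h : ∀ j, ∃ p q : ℕ, 0 < p ∧ 0 < q ∧ ρ j ^ p = lam ^ q) :
    ∃ r : ℝ, 0 < r ∧ r < 1 ∧ ∃ k : ℕ, 0 < k ∧ lam = r ^ k ∧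
      ∃ (σ : Equiv.Perm (Fin t)) (κ : Fin t → ℕ), (∀ j, 0 < κ j) ∧ Monotone κ ∧
        ∀ j, ρ (σ j) = r ^ κ j := by
  choose p q hp hq hpq using h
  -- Formally `ρ j = lam ^ (q j / p j)`, and `k` is a common denominator of these exponents.
  set k := ∏ j, p j
  have hk : 0 < k := Finset.prod_pos fun j _ => hp j
  have hk0 : (k : ℝ) ≠ 0 := by exact_mod_cast hk.ne'
  set r := lam ^ (1 / (k : ℝ)) with hr
  have hr0 : 0 < r := Real.rpow_pos_of_pos hl0 _
  have hr1 : r < 1 := Real.rpow_lt_one hl0.le hl1 (by positivity)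
  have hrk : lam = r ^ k := by
    rw [hr, ← Real.rpow_natCast, ← Real.rpow_mul hl0.le, one_div_mul_cancel hk0, Real.rpow_one]
  have hex : ∀ j, ∃ e : ℕ, 0 < e ∧ ρ j = r ^ e := by
    intro j
    obtain ⟨c, hc⟩ : p j ∣ k := Finset.dvd_prod_of_mem p (Finset.mem_univ j)
    have hc0 : 0 < c := Nat.pos_of_ne_zero fun h0 => by simp [h0] at hc; omega
    refine ⟨c * q j, Nat.mul_pos hc0 (hq j), ?_⟩
    have : ρ j ^ p j = (r ^ (c * q j)) ^ p j := by
      rw [hpq, hrk, hc, ← pow_mul, ← pow_mul]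
      congr 1; ring
    exact (pow_left_inj₀ (hρ0 j).le (by positivity) (hp j).ne').1 this
  choose e he hρe using hex
  exact ⟨r, hr0, hr1, k, hk, hrk, Tuple.sort e, e ∘ Tuple.sort e, fun j => he _,
    Tuple.monotone_sort e, fun j => hρe _⟩

/-! ### Transfer of cylinders from `F` to `E`, and conclusion. -/

theorem LipschitzEquivalent.exists_inverse {X Y : Type*} [MetricSpace X] [MetricSpace Y]
    {A : Set X} {B : Set Y} (hA : A.Nonempty) (h : LipschitzEquivalent A B) :
    ∃ (φ : Y → X) (C : ℝ), 0 < C ∧ φ '' B = A ∧ ∀ x ∈ B, ∀ y ∈ B,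
      dist (φ x) (φ y) ≤ C * dist x y ∧ dist x y ≤ C * dist (φ x) (φ y) := by
  classical
  obtain ⟨f, hf, C, hC, hdist⟩ := h
  obtain ⟨a₀, -⟩ := hA
  set e := Equiv.ofBijective f hf
  have hφ : ∀ y : B, (if hy : (y : Y) ∈ B then (e.symm ⟨y, hy⟩ : X) else a₀) = e.symm y :=
    fun y => dif_pos y.2
  refine ⟨fun y => if hy : y ∈ B then (e.symm ⟨y, hy⟩ : X) else a₀, C, hC, ?_, ?_⟩
  · ext a
    constructor
    · rintro ⟨y, hy, rfl⟩
      simp only [dif_pos hy]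
      exact (e.symm ⟨y, hy⟩).2
    · intro ha
      refine ⟨e ⟨a, ha⟩, (e ⟨a, ha⟩).2, ?_⟩
      exact (hφ (e ⟨a, ha⟩)).trans (by rw [Equiv.symm_apply_apply])
  · intro x hx y hy
    have h1 := hdist (e.symm ⟨x, hx⟩) (e.symm ⟨y, hy⟩)
    have h2 : ∀ z, f (e.symm z) = z := e.apply_symm_apply
    rw [h2, h2, inv_mul_le_iff₀ hC] at h1
    simp only [dif_pos hx, dif_pos hy]
    exact h1

section

variable {d t : ℕ} {g : Fin t → EuclideanSpace ℝ (Fin d) → EuclideanSpace ℝ (Fin d)}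
  {ρ : Fin t → ℝ} {F : Set (EuclideanSpace ℝ (Fin d))}

/-- A single map would send `F` onto itself while shrinking its positive diameter. -/
theorem IsSelfSimilarSet.two_le (hF : IsSelfSimilarSet g ρ F) (hnt : F.Nontrivial) : 2 ≤ t := by
  by_contra hlt
  obtain ⟨j⟩ := hF.nonempty_index
  have hsub : Subsingleton (Fin t) := by
    have : t = 1 := by have := j.2; omega
    subst this; infer_instance
  have himg : wordMap g [j] '' F = F := by
    have h1 := hF.wordMap_image_eq_iUnion []
    refine Subset.antisymm (hF.wordMap_image_subset _) fun x hx => ?_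
    have hx' : x ∈ wordMap g [] '' F := by simpa [wordMap] using hx
    rw [h1] at hx'
    obtain ⟨i, hi⟩ := mem_iUnion.1 hx'
    rwa [Subsingleton.elim i j] at hi
  have hle := hF.ediam_wordMap_image_le [j]
  rw [himg, wordProd_cons, wordProd_nil, mul_one] at hle
  have hle' : Metric.diam F ≤ ρ j * Metric.diam F :=
    ENNReal.toReal_le_of_le_ofReal (mul_nonneg (hF.ratio_pos j).le Metric.diam_nonneg) hle
  obtain ⟨x, hx, y, hy, hxy⟩ := hnt
  have hpos : 0 < Metric.diam F :=
    (dist_pos.2 hxy).trans_le (Metric.dist_le_diam_of_mem hF.isCompact.isBounded hx hy)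
  have := hF.ratio_lt_one j
  nlinarith

variable {φ : EuclideanSpace ℝ (Fin d) → ℝ} {C s : ℝ}

/-- Positivity, finiteness, additivity and growth of the Hausdorff measure of the images of the
cylinders under a bi-Lipschitz map. -/
theorem IsDustLike.hausdorffMeasure_image_wordMap (hF : IsDustLike g ρ F) (hs : 0 < s)
    (hsum : ∑ j, ρ j ^ s = 1) (hC : 0 < C)
    (hφ : ∀ x ∈ F, ∀ y ∈ F, dist (φ x) (φ y) ≤ C * dist x y ∧ dist x y ≤ C * dist (φ x) (φ y)) :
    (∀ w, 0 < (μH[s] (φ '' (wordMap g w '' F))).toReal) ∧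
    (∀ w, (μH[s] (φ '' (wordMap g w '' F))).toReal =
      ∑ j, (μH[s] (φ '' (wordMap g (w ++ [j]) '' F))).toReal) ∧
    ∃ K, ∀ w, (μH[s] (φ '' (wordMap g w '' F))).toReal ≤ K * wordProd ρ w ^ s := by
  have hsub := hF.wordMap_image_subset
  have hinj : InjOn φ F := fun x hx y hy hxy => by
    have h := (hφ x hx y hy).2
    rw [hxy, dist_self, mul_zero] at h
    exact dist_le_zero.1 h
  have hlip : LipschitzOnWith C.toNNReal φ F := LipschitzOnWith.of_dist_le_mul fun x hx y hy => by
    rw [Real.coe_toNNReal _ hC.le]; exact (hφ x hx y hy).1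
  have hlip' : LipschitzOnWith C.toNNReal (Function.invFunOn φ F) (φ '' F) := by
    refine LipschitzOnWith.of_dist_le_mul ?_
    rintro _ ⟨x, hx, rfl⟩ _ ⟨y, hy, rfl⟩
    rw [Real.coe_toNNReal _ hC.le, hinj.leftInvOn_invFunOn hx, hinj.leftInvOn_invFunOn hy]
    exact (hφ x hx y hy).2
  have hCs : ((C.toNNReal : NNReal) : ENNReal) ^ s = ENNReal.ofReal (C ^ s) :=
    ENNReal.ofReal_rpow_of_pos hC
  have hFw : ∀ w, μH[s] (wordMap g w '' F) = ENNReal.ofReal (wordProd ρ w ^ s) * μH[s] F :=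
    fun w => hausdorffMeasure_image_of_dist_eq (wordProd_pos hF.ratio_pos w) hs.le
      (hF.dist_wordMap w) F
  have hFtop := hF.hausdorffMeasure_lt_top hs hsum
  have hFpos := hF.hausdorffMeasure_pos hs hsum
  have hupper : ∀ w, μH[s] (φ '' (wordMap g w '' F)) ≤
      ENNReal.ofReal (C ^ s) * (ENNReal.ofReal (wordProd ρ w ^ s) * μH[s] F) := fun w => by
    rw [← hFw, ← hCs]
    exact (hlip.mono (hsub w)).hausdorffMeasure_image_le hs.le
  have hbtop : ∀ w, ENNReal.ofReal (C ^ s) * (ENNReal.ofReal (wordProd ρ w ^ s) * μH[s] F) ≠ ⊤ :=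
    fun w => ENNReal.mul_ne_top ENNReal.ofReal_ne_top
      (ENNReal.mul_ne_top ENNReal.ofReal_ne_top hFtop.ne)
  have htop : ∀ w, μH[s] (φ '' (wordMap g w '' F)) ≠ ⊤ :=
    fun w => ne_top_of_le_ne_top (hbtop w) (hupper w)
  refine ⟨fun w => ENNReal.toReal_pos (fun h0 => ?_) (htop w), fun w => ?_,
    C ^ s * (μH[s] F).toReal, fun w => ?_⟩
  -- A null image would pull back, under the Lipschitz inverse, to a null cylinder.
  · have h1 := (hlip'.mono (image_mono (hsub w))).hausdorffMeasure_image_le hs.le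
    rw [hinj.invFunOn_image (hsub w), h0, mul_zero, hFw] at h1
    have hw := Real.rpow_pos_of_pos (wordProd_pos hF.ratio_pos w) s
    exact absurd h1 (not_le.2 (ENNReal.mul_pos (ENNReal.ofReal_pos.2 hw).ne' hFpos.ne'))
  · rw [← ENNReal.toReal_sum fun j _ => htop _]
    congr 1
    conv_lhs => rw [hF.wordMap_image_eq_iUnion, image_iUnion]
    rw [measure_iUnion, tsum_fintype]
    · intro i j hij
      exact (hF.disjoint_children w hij).image hinj (hsub _) (hsub _)
    · intro j
      exact ((hF.isCompact_wordMap_image _).image_of_continuousOn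
        (hlip.continuousOn.mono (hsub _))).measurableSet
  · have h1 := ENNReal.toReal_mono (hbtop w) (hupper w)
    have hw := Real.rpow_pos_of_pos (wordProd_pos hF.ratio_pos w) s
    have hCp := Real.rpow_pos_of_pos hC s
    rw [ENNReal.toReal_mul, ENNReal.toReal_mul, ENNReal.toReal_ofReal hCp.le,
      ENNReal.toReal_ofReal hw.le] at h1
    linarith

/-- Up to powers of `lam ^ s`, the images in `E` of the cylinders of `F` have only finitely many
Hausdorff measures. -/
theorem IsDustLike.finite_values (hF : IsDustLike g ρ F) (hs : 0 ≤ s) (hC : 0 < C)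
    (hφ : ∀ x ∈ F, ∀ y ∈ F, dist (φ x) (φ y) ≤ C * dist x y ∧ dist x y ≤ C * dist (φ x) (φ y))
    {n m : ℕ} {lam : ℝ} {b : Fin n → ℝ} (hb : IsExactOverlapSystem lam m b) {E : Set ℝ}
    (hEc : IsCompact E) (hE : E = ⋃ i, overlapMap lam b i '' E) (hφE : φ '' F = E) :
    ∃ (κ κ' : ℝ) (V : Set ℝ), 0 < κ ∧ V.Finite ∧ ∀ w : List (Fin t), ∃ N : ℕ,
      κ * wordProd ρ w ≤ lam ^ N ∧ lam ^ N ≤ κ' * wordProd ρ w ∧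
      ∃ v ∈ V, (μH[s] (φ '' (wordMap g w '' F))).toReal = (lam ^ N) ^ s * v := by
  have hl0 := hb.lam_pos
  have hl1 := hb.lam_lt_one
  obtain ⟨c, hc, hsep⟩ := hF.exists_separation
  have hρpos := wordProd_pos hF.ratio_pos
  have hDE : 0 < Metric.diam E + 1 := by have := Metric.diam_nonneg (s := E); linarith
  -- With `lam ^ N ≤ κ' * wordProd ρ w`, level `N` cylinders of `E` are too short to leave `φ ''
  -- F_w`. The bound `1` ensures that a suitable `N` exists; the `+ 1` makes the comparison strict.
  set κ' : ℝ := min 1 (c / (C * (Metric.diam E + 1)))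
  have hκ' : 0 < κ' := lt_min one_pos (by positivity)
  -- The radius bounds the diameter of `φ '' F_w` relative to the chosen cylinder scale.
  obtain ⟨S, hS, hfin⟩ := hb.finite_type (C * Metric.diam F / (lam * κ'))
  refine ⟨lam * κ', κ', (fun S' => (μH[s] (⋃ δ ∈ S', (fun e => δ + e) '' E)).toReal) '' 𝒫 S,
    by positivity, hS.powerset.image _, fun w => ?_⟩
  have hw := hρpos w
  have hw1 : wordProd ρ w ≤ 1 := by
    simpa using wordProd_le_pow hF.ratio_pos (fun j => (hF.ratio_lt_one j).le) w
  obtain ⟨N, hN1, hN2⟩ := exists_nat_pow_near_of_lt_one (x := κ' * wordProd ρ w) (by positivity)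
    (mul_le_one₀ (min_le_left _ _) hw.le hw1) hl0 hl1
  have hNlow : lam * κ' * wordProd ρ w ≤ lam ^ (N + 1) := by
    rw [pow_succ', mul_assoc]; gcongr
  refine ⟨N + 1, hNlow, hN1.le, ?_⟩
  set δ := lam ^ (N + 1) with hδ
  have hδ0 : 0 < δ := by positivity
  set A := φ '' (wordMap g w '' F) with hA
  have hAE : A ⊆ E := hφE ▸ image_mono (hF.wordMap_image_subset w)
  set T := {x ∈ levelPoints lam b (N + 1) | (fun e => x + δ * e) '' E ⊆ A} with hT
  have hgap : ∀ z ∈ A, ∀ z' ∈ E, dist z z' ≤ δ * Metric.diam E → z' ∈ A := by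
    intro z hz z' hz' hzz
    rw [← hφE] at hz'
    obtain ⟨x, hx, rfl⟩ := hz
    obtain ⟨y, hy, rfl⟩ := hz'
    by_contra hcon
    have h1 := hsep w x hx y hy fun hmem => hcon ⟨y, hmem, rfl⟩
    have h2 := (hφ x (hF.wordMap_image_subset w hx) y hy).2
    have h3 : κ' * (C * (Metric.diam E + 1)) ≤ c :=
      (le_div_iff₀ (by positivity)).1 (min_le_right _ _)
    have h4 : C * (δ * (Metric.diam E + 1)) ≤ c * wordProd ρ w := by
      calc C * (δ * (Metric.diam E + 1)) ≤ C * (κ' * wordProd ρ w * (Metric.diam E + 1)) := by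
            gcongr
        _ = κ' * (C * (Metric.diam E + 1)) * wordProd ρ w := by ring
        _ ≤ _ := by gcongr
    have h5 : C * dist (φ x) (φ y) ≤ C * (δ * Metric.diam E) := by gcongr
    have h6 : 0 < C * δ := by positivity
    nlinarith
  have hcover : A = ⋃ x ∈ T, (fun e => x + δ * e) '' E := by
    refine Subset.antisymm (fun z hz => ?_) (iUnion₂_subset fun x hx => hx.2)
    have hzE := hAE hz
    rw [eq_biUnion_levelPoints hE (N + 1)] at hzE
    obtain ⟨x, hx, e, he, rfl⟩ := mem_iUnion₂.1 hzE
    refine mem_iUnion₂.2 ⟨x, ⟨hx, ?_⟩, e, he, rfl⟩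
    rintro _ ⟨e', he', rfl⟩
    refine hgap _ hz _ ?_ ?_
    · rw [eq_biUnion_levelPoints hE (N + 1)]
      exact mem_iUnion₂.2 ⟨x, hx, e', he', rfl⟩
    · have := Metric.dist_le_diam_of_mem hEc.isBounded he he'
      simp only [dist_add_left]
      rw [Real.dist_eq, ← mul_sub, abs_mul, abs_of_pos hδ0, ← Real.dist_eq]
      gcongr
  obtain ⟨p, hp⟩ := hF.nonempty
  have hp' : φ (wordMap g w p) ∈ A := ⟨_, ⟨p, hp, rfl⟩, rfl⟩
  obtain ⟨x₀, hx₀, e₀, he₀, -⟩ := mem_iUnion₂.1 (hcover.subset hp')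
  have hclose : ∀ x ∈ T, (x - x₀) / δ ∈ S := by
    intro x hx
    refine hfin (N + 1) x hx.1 x₀ hx₀.1 ?_
    obtain ⟨_, ⟨q, hq, rfl⟩, hq'⟩ := hx.2 ⟨e₀, he₀, rfl⟩
    obtain ⟨_, ⟨q₀, hq₀, rfl⟩, hq₀'⟩ := hx₀.2 ⟨e₀, he₀, rfl⟩
    have hmem := fun q hq => hF.wordMap_image_subset w ⟨q, hq, rfl⟩
    have h1 := (hφ _ (hmem q hq) _ (hmem q₀ hq₀)).1
    rw [hq', hq₀', hF.dist_wordMap, dist_add_right, Real.dist_eq] at h1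
    have h2 := Metric.dist_le_diam_of_mem hF.isCompact.isBounded hq hq₀
    calc |x - x₀| ≤ C * (wordProd ρ w * Metric.diam F) := h1.trans (by gcongr)
      _ = C * Metric.diam F / (lam * κ') * (lam * κ' * wordProd ρ w) := by field_simp
      _ ≤ _ := by
        have := Metric.diam_nonneg (s := F)
        gcongr
  -- Seen from the base cylinder at `x₀`, the set `A` is a copy, scaled by `δ`, of a union of
  -- translates of `E` by a subset of the finite set `S`.
  have hshape : A = (fun y => x₀ + δ * y) ''
      (⋃ r ∈ (fun x => (x - x₀) / δ) '' T, (fun e => r + e) '' E) := by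
    rw [hcover, biUnion_image, image_iUnion₂]
    refine iUnion₂_congr fun x _ => ?_
    rw [image_image]
    refine image_congr fun e _ => ?_
    field_simp; ring
  refine ⟨_, ⟨(fun x => (x - x₀) / δ) '' T, ?_, rfl⟩, ?_⟩
  · rintro _ ⟨x, hx, rfl⟩
    exact hclose x hx
  · conv_lhs => rw [hshape]
    rw [hausdorffMeasure_image_of_dist_eq hδ0 hs, ENNReal.toReal_mul,
      ENNReal.toReal_ofReal (by positivity)]
    intro x y
    rw [dist_add_left, Real.dist_eq, ← mul_sub, abs_mul, abs_of_pos hδ0, ← Real.dist_eq]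

end

theorem IsExactOverlapSystem.nontrivial {n m : ℕ} {lam : ℝ} {b : Fin n → ℝ}
    (hb : IsExactOverlapSystem lam m b) {E : Set ℝ} (hne : E.Nonempty)
    (hE : E = ⋃ i, overlapMap lam b i '' E) : E.Nontrivial := by
  obtain ⟨x, hx⟩ := hne
  have hn := hb.add_two_le
  have hmem : ∀ i, overlapMap lam b i x ∈ E := fun i => by
    rw [hE]; exact mem_iUnion.2 ⟨i, x, hx, rfl⟩
  refine ⟨_, hmem ⟨0, by omega⟩, _, hmem ⟨1, by omega⟩, ?_⟩
  have : b ⟨0, by omega⟩ < b ⟨1, by omega⟩ := hb.strictMono (by simp [Fin.lt_def])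
  simp only [overlapMap]
  linarith

theorem proposition1 (lam : ℝ) (n m : ℕ) (E : Set ℝ) (hE : E ∈ exactOverlapClass lam n m)
    (d t : ℕ) (g : Fin t → EuclideanSpace ℝ (Fin d) → EuclideanSpace ℝ (Fin d)) (ρ : Fin t → ℝ)
    (F : Set (EuclideanSpace ℝ (Fin d))) (hF : IsDustLike g ρ F)
    (hEF : LipschitzEquivalent E F) :
    ∃ r : ℝ, 0 < r ∧ r < 1 ∧ ∃ k : ℕ, 0 < k ∧ lam = r ^ k ∧
      ∃ (σ : Equiv.Perm (Fin t)) (κ : Fin t → ℕ), (∀ j, 0 < κ j) ∧ Monotone κ ∧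
        ∀ j, ρ (σ j) = r ^ κ j := by
  obtain ⟨b, hb, hEc, hEne, hEeq⟩ := hE
  obtain ⟨φ, C, hC, hφE, hφ⟩ := hEF.exists_inverse hEne
  have hnt : F.Nontrivial := by
    have h := hb.nontrivial hEne hEeq
    rw [← hφE] at h
    obtain ⟨_, ⟨x, hx, rfl⟩, _, ⟨y, hy, rfl⟩, hne⟩ := h
    exact ⟨x, hx, y, hy, fun hxy => hne (congrArg φ hxy)⟩
  obtain ⟨s, hs, hsum⟩ := exists_sum_rpow_eq_one (hF.two_le hnt) hF.ratio_pos hF.ratio_lt_one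
  obtain ⟨hpos, hadd, K, hK⟩ := hF.hausdorffMeasure_image_wordMap hs hsum hC hφ
  obtain ⟨κ, κ', V, hκ, hV, hval⟩ := hF.finite_values hs.le hC hφ hb hEc hEeq hφE
  exact exists_common_root hF.ratio_pos hb.lam_pos hb.lam_lt_one
    (exists_pow_eq_pow_of_finite_values hF.ratio_pos hF.ratio_lt_one hs hsum hb.lam_pos
      hb.lam_lt_one hpos hadd hK hκ hV hval)
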